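/- Let $\varepsilon=\frac{\sqrt3}{9\pi}$ (a known lower bound for the Margulis constant of hyperbolic $4$-space) and $c(\varepsilon)=\frac{1}{\sqrt{2\cosh(\varepsilon)-2}}$. For an irrational $\alpha\in\mathbb R/\mathbb Z$, let $\mathscr B_\alpha:[0,\infty)\to\mathbb R$, $$\mathscr B_\alpha(r)=\inf_{j\ge 1} u_{\alpha,j}(r),\qquad u_{\alpha,j}(r)=c(\varepsilon)\sqrt{4\sin^2(\pi j\alpha)\,r^2+j^2},$$ where $j$ runs over the positive integers, be the boundary function of the Margulis region (with parameter $\varepsilon$) of the screw translation of hyperbolic $4$-space with rotation angle $\alpha$. Let $[a_1,a_2,a_3,\ldots]$ be the continued fraction expansion of the representative of $\alpha$ in $(0,1)$, and let $q_n$ be the denominator of its $n$-th convergent $p_n/q_n=[a_1,\ldots,a_n]$ in lowest terms (so $q_0=1$, $q_1=a_1$, and $q_n=a_nq_{n-1}+q_{n-2}$ for $n\ge2$). Then for every irrational $\alpha\in\mathbb R/\mathbb Z$, $$\mathscr B_\alpha(r)\le 1000\sqrt r\qquad\text{for all } r\ge\sqrt2\,q_7^2 .$$ -/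

import Mathlib

/-- The normalizing constant `c(ε) = 1 / √(2 cosh ε - 2)`. -/
noncomputable def margulisScale (ε : ℝ) : ℝ :=
  1 / Real.sqrt (2 * Real.cosh ε - 2)

/-- `u_{α,j}(r) = c(ε) √(4 sin²(π j α) r² + j²)`: a point `(r, θ, z, t)` of hyperbolic 4-space is
moved a distance less than `ε` by the `j`-th power of the screw translation
`(r, θ, z, t) ↦ (r, θ + α, z + 1, t)` if and only if `t > u_{α,j}(r)`. -/
noncomputable def screwHeight (ε α : ℝ) (j : ℕ) (r : ℝ) : ℝ :=
  margulisScale ε * Real.sqrt (4 * Real.sin (Real.pi * j * α) ^ 2 * r ^ 2 + (j : ℝ) ^ 2)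

/-- The boundary function `𝓑_α(r) = inf_{j ≥ 1} u_{α,j}(r)` of the Margulis region, with
parameter `ε`; it depends only on the class of `α` in `ℝ/ℤ`. -/
noncomputable def boundaryFunction (ε α r : ℝ) : ℝ :=
  ⨅ j : ℕ+, screwHeight ε α (j : ℕ) r

/-- The denominator `q_n` of the `n`-th convergent of the regular continued fraction
of `α`, so that `q_0 = 1` and `q_1 = a_1` is the first partial quotient of the fractional part
of `α`. The integer part of `α` has no influence on it. -/
noncomputable def convergentDenominator (α : ℝ) (n : ℕ) : ℝ :=
  (GenContFract.of α).dens n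

/-! Dirichlet's theorem with `N = ⌊√r⌋` gives `1 ≤ j ≤ √r` with `jα` within `1/√r` of an integer.
Then `4 sin²(πjα) r² ≤ 4π² r` and `j² ≤ r`, so `u_{α,j}(r) ≤ c(ε) √(4π² + 1) √r` for all `r ≥ 1`.
Since `c(ε) ≤ 1/ε ≤ 17`, the constant is at most `17 · 7 = 119`. Of `q_7` only `q_7 ≥ 1` matters. -/

theorem margulisScale_nonneg (ε : ℝ) : 0 ≤ margulisScale ε := by
  unfold margulisScale
  positivity

/-- `2 cosh ε - 2 = 4 sinh²(ε/2) ≥ ε²`. -/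
theorem margulisScale_le_inv {ε : ℝ} (hε : 0 < ε) : margulisScale ε ≤ ε⁻¹ := by
  have hsinh : ε / 2 ≤ Real.sinh (ε / 2) := Real.self_le_sinh_iff.2 (by positivity)
  have hcosh : Real.cosh ε = 1 + 2 * Real.sinh (ε / 2) ^ 2 := by
    have h := Real.cosh_two_mul (ε / 2)
    rw [mul_div_cancel₀ ε two_ne_zero, Real.cosh_sq] at h
    linarith
  unfold margulisScale
  rw [one_div]
  refine inv_anti₀ hε (Real.le_sqrt_of_sq_le ?_)
  nlinarith

theorem margulisScale_sqrt_three_div_le :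
    margulisScale (Real.sqrt 3 / (9 * Real.pi)) ≤ 17 := by
  refine (margulisScale_le_inv (by positivity)).trans ?_
  have h3 : (1.7 : ℝ) ≤ Real.sqrt 3 := Real.le_sqrt_of_sq_le (by norm_num)
  rw [inv_div, div_le_iff₀ (by positivity)]
  linarith [Real.pi_lt_d2]

theorem one_le_convergentDenominator (α : ℝ) (n : ℕ) : 1 ≤ convergentDenominator α n := by
  induction n with
  | zero => simp [convergentDenominator]
  | succ n ih => exact ih.trans GenContFract.of_den_mono

theorem boundaryFunction_le_screwHeight (ε α r : ℝ) {j : ℕ} (hj : 0 < j) :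
    boundaryFunction ε α r ≤ screwHeight ε α j r := by
  refine ciInf_le ⟨0, ?_⟩ (⟨j, hj⟩ : ℕ+)
  rintro _ ⟨k, rfl⟩
  exact mul_nonneg (margulisScale_nonneg ε) (Real.sqrt_nonneg _)

theorem abs_sin_pi_mul_le (x : ℝ) (m : ℤ) : |Real.sin (Real.pi * x)| ≤ Real.pi * |x - m| := by
  have h : |Real.sin (Real.pi * x)| = |Real.sin (Real.pi * (x - m))| := by
    rw [mul_sub, mul_comm Real.pi (m : ℝ), Real.sin_sub_int_mul_pi]
    simp [abs_mul, abs_zpow]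
  rw [h, ← abs_of_pos Real.pi_pos, ← abs_mul, abs_of_pos Real.pi_pos]
  exact Real.abs_sin_le_abs

/-- Dirichlet's approximation theorem bounds the boundary function by a multiple of `√r`. -/
theorem boundaryFunction_le_mul_sqrt (ε α : ℝ) {r : ℝ} (hr : 1 ≤ r) :
    boundaryFunction ε α r ≤
      margulisScale ε * (Real.sqrt (4 * Real.pi ^ 2 + 1) * Real.sqrt r) := by
  have hr0 : 0 ≤ r := zero_le_one.trans hr
  have hs : 1 ≤ Real.sqrt r := Real.one_le_sqrt.2 hr
  obtain ⟨j, hj, hjN, happrox⟩ :=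
    Real.exists_nat_abs_mul_sub_round_le α (Nat.floor_pos.2 hs)
  refine (boundaryFunction_le_screwHeight ε α r hj).trans ?_
  refine mul_le_mul_of_nonneg_left ?_ (margulisScale_nonneg ε)
  rw [← Real.sqrt_mul (by positivity)]
  refine Real.sqrt_le_sqrt ?_
  have hjr : (j : ℝ) ^ 2 ≤ r :=
    (Real.le_sqrt (by positivity) hr0).1
      ((Nat.cast_le.2 hjN).trans (Nat.floor_le (Real.sqrt_nonneg r)))
  have hdist : |(j : ℝ) * α - round ((j : ℝ) * α)| * Real.sqrt r ≤ 1 := by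
    -- Dirichlet's bound is `1/(N + 1)`, and `√r < N + 1`, so rounding `√r` down costs nothing.
    refine (mul_le_mul_of_nonneg_left (Nat.lt_floor_add_one _).le (abs_nonneg _)).trans ?_
    exact (le_div_iff₀ (by positivity)).1 happrox
  have hsin : |Real.sin (Real.pi * j * α)| * Real.sqrt r ≤ Real.pi := by
    rw [mul_assoc]
    calc |Real.sin (Real.pi * (j * α))| * Real.sqrt r
        ≤ Real.pi * |(j : ℝ) * α - round ((j : ℝ) * α)| * Real.sqrt r := by
          gcongr
          exact abs_sin_pi_mul_le _ _
      _ ≤ Real.pi := by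
          rw [mul_assoc]
          exact mul_le_of_le_one_right Real.pi_pos.le hdist
  have hsq : Real.sin (Real.pi * j * α) ^ 2 * r ≤ Real.pi ^ 2 := by
    have h := pow_le_pow_left₀ (by positivity) hsin 2
    rwa [mul_pow, sq_abs, Real.sq_sqrt hr0] at h
  linarith [mul_le_mul_of_nonneg_right hsq hr0]

theorem mainTheorem12 (α : ℝ) (hα : Irrational α) (r : ℝ)
    (hr : Real.sqrt 2 * convergentDenominator α 7 ^ 2 ≤ r) :
    boundaryFunction (Real.sqrt 3 / (9 * Real.pi)) α r ≤ 1000 * Real.sqrt r := by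
  have hr1 : 1 ≤ r :=
    (one_le_mul_of_one_le_of_one_le (Real.one_le_sqrt.2 one_le_two)
      (one_le_pow₀ (one_le_convergentDenominator α 7))).trans hr
  have hpi : Real.sqrt (4 * Real.pi ^ 2 + 1) ≤ 7 := by
    refine Real.sqrt_le_iff.2 ⟨by norm_num, ?_⟩
    nlinarith [Real.pi_lt_d2, Real.pi_pos]
  calc boundaryFunction (Real.sqrt 3 / (9 * Real.pi)) α r
      ≤ margulisScale (Real.sqrt 3 / (9 * Real.pi)) *
          (Real.sqrt (4 * Real.pi ^ 2 + 1) * Real.sqrt r) :=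
        boundaryFunction_le_mul_sqrt _ α hr1
    _ ≤ 17 * (7 * Real.sqrt r) := by
        gcongr
        exact margulisScale_sqrt_three_div_le
    _ ≤ 1000 * Real.sqrt r := by linarith [Real.sqrt_nonneg r]
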